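/- Let $\mathcal V$ be a countably infinite set of names, let $\mathfrak S(\mathcal V)$ be the group of permutations of $\mathcal V$ generated by transpositions, and let $\mathsf{Nom}$ be the category of nominal sets over $\mathcal V$ (sets with an $\mathfrak S(\mathcal V)$-action all of whose elements have finite support) and equivariant maps. Write $\mathsf{supp}(u)$ for the least finite support of $u$, and $[\mathcal V]X=(\mathcal V\times X)/{\sim_\alpha}$ for the abstraction of $X$, where $(x_1,u_1)\sim_\alpha(x_2,u_2)$ iff $(x_1\,z)\cdot u_1=(x_2\,z)\cdot u_2$ for some name $z$ fresh for $x_1,u_1,x_2,u_2$. Write $\langle x\rangle u$ for the class of $(x,u)$, and $\theta_X:\mathcal V\times X\to[\mathcal V]X$, $(x,u)\mapsto\langle x\rangle u$. Safe elements and safe squares. For an equivariant map $f:X\to W$ and $u\in X$ put $\mathsf{bv}_f(u)=\mathsf{supp}(u)\setminus\mathsf{supp}(f(u))$; call $u$ $f$-safe if $|\mathsf{supp}(u)|=\max\{|\mathsf{supp}(v)| : v\in f^{-1}(f(u))\}$ (in particular, the maximum exists). A commutative square of equivariant maps $p:Z\to X$, $f:X\to W$, $g:Z\to Y$, $q:Y\to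 W$ (so $f\circ p=q\circ g$) is a safe square if for every $f$-safe $u\in X$ and every $v\in Y$ with $f(u)=q(v)$ and $\mathsf{bv}_f(u)\cap\mathsf{supp}(v)=\emptyset$ there is a $g$-safe $z\in Z$ with $p(z)=u$ and $g(z)=v$. Functors. Let $F_\alpha:\mathsf{Nom}\to\mathsf{Nom}$ be a functor built from the grammar $$F::=\mathcal V\mid K\mid \mathsf{Id}\mid \textstyle\coprod_{i\in I} F_i\mid F\times F\mid[\mathcal V]F ,$$ where $K$ is a constant functor at any nominal set and $I$ is any set. (In particular, $F_\alpha X=\mathcal V+\coprod_{\mathsf{op}\in\Sigma}[\mathcal V]^{n_1}X\times\dots\times[\mathcal V]^{n_k}X$, with $\mathsf{ar}(\mathsf{op})=n_1,\dots,n_k$, for any binding signature $(\Sigma,\mathsf{ar})$.) Let $F$ be the functor obtained by replacing all occurrences of $[\mathcal V](-)$ in the expression by $\mathcal V\times(-)$, and let $q:F\to F_\alpha$ be the natural transformation defined by recursion on the expression: it is the identity for $\mathcal V$, $K$ and $\mathsf{Id}$, it is formed componentwise for products and coproducts, and for $F_\alpha=[\mathcal V]F'_\alpha$ it is $\theta\circ(\mathcal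 V\times q')$. Let $1$ be the terminal nominal set. Define $[-]_\alpha^{0}=\mathrm{id}_1$ and $[-]_\alpha^{n+1}=q_{F_\alpha^n1}\circ F([-]_\alpha^{n}):F^{n+1}1\to F_\alpha^{n+1}1$. Let $F^n!:F^{n+1}1\to F^n1$ and $F_\alpha^n!:F_\alpha^{n+1}1\to F_\alpha^n1$ be the connecting maps of the final chains, where $!$ is the unique map to $1$. **Proposition.** For every $n\ge 0$ the square $$\begin{array}{ccc}F^n1&\xleftarrow{\;F^n!\;}&F^{n+1}1\\ {\scriptstyle[-]_\alpha^{n}}\downarrow&&\downarrow{\scriptstyle[-]_\alpha^{n+1}}\\ F_\alpha^n1&\xleftarrow{\;F_\alpha^n!\;}&F_\alpha^{n+1}1\end{array}$$ is a safe square. -/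

import Mathlib

universe u

namespace NomSquare

/-! Nominal sets over a set `V` of names. -/

/-- The group of permutations of the set of names `V` generated by transpositions. -/
abbrev NamePerm (V : Type u) [DecidableEq V] : Type u :=
  Subgroup.closure {σ : Equiv.Perm V | σ.IsSwap}

/-- The transposition `(x y)`, as an element of `NamePerm V`. -/
def transp {V : Type u} [DecidableEq V] (x y : V) : NamePerm V :=
  ⟨Equiv.swap x y, by
    by_cases h : x = y
    · subst h
      rw [Equiv.swap_self]
      exact Subgroup.one_mem _
    · exact Subgroup.subset_closure ⟨x, y, h, rfl⟩⟩

/-- A nominal set: a set with an action of `NamePerm V`, all of whose elements are finitely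
supported.  `MulAction.Supports G S x` says that every `π : G` fixing all members of `S`
fixes `x`. -/
structure NomSet (V : Type u) [DecidableEq V] : Type (u + 1) where
  carrier : Type u
  [action : MulAction (NamePerm V) carrier]
  finitelySupported : ∀ x : carrier, ∃ S : Set V, S.Finite ∧ MulAction.Supports (NamePerm V) S x

instance {V : Type u} [DecidableEq V] : CoeSort (NomSet V) (Type u) := ⟨NomSet.carrier⟩

instance {V : Type u} [DecidableEq V] (X : NomSet V) : MulAction (NamePerm V) X := X.action

/-- Morphisms of nominal sets are the equivariant maps. -/
abbrev Hom {V : Type u} [DecidableEq V] (X Y : NomSet V) : Type u :=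
  X →[NamePerm V] Y

/-- The support of `x`: the intersection of all finite sets supporting `x`, which (for infinite
`V`) is the smallest finite set supporting `x`. -/
def supp {V : Type u} [DecidableEq V] {X : NomSet V} (x : X) : Set V :=
  ⋂₀ {S : Set V | S.Finite ∧ MulAction.Supports (NamePerm V) S x}

section Helpers

variable {V : Type u} [DecidableEq V]

@[simp] theorem transp_smul (x y a : V) : transp x y • a = Equiv.swap x y a := rfl

theorem transp_mul_self (x y : V) : transp x y * transp x y = 1 :=
  Subtype.ext (Equiv.swap_mul_self x y)

theorem transp_conj (π : NamePerm V) (x y : V) :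
    π * transp x y = transp (π • x) (π • y) * π := by
  apply Subtype.ext
  exact Equiv.mul_swap_eq_swap_mul π.1 x y

theorem supports_smul {X : NomSet V} {S : Set V} {x : X} (π : NamePerm V)
    (h : MulAction.Supports (NamePerm V) S x) :
    MulAction.Supports (NamePerm V) ((fun a => π⁻¹ • a) ⁻¹' S) (π • x) := by
  intro g hg
  have : (π⁻¹ * g * π) • x = x := by
    apply h
    intro a ha
    have := @hg (π • a) (by simpa using ha)
    rw [mul_smul, mul_smul, this, inv_smul_smul]
  rw [mul_smul, mul_smul, inv_smul_eq_iff] at this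
  exact this

theorem supp_smul_subset {X : NomSet V} {x : X} (π : NamePerm V) {a : V} (h : a ∉ supp x) :
    π • a ∉ supp (π • x) := by
  simp only [supp, Set.mem_sInter, not_forall] at h ⊢
  obtain ⟨S, ⟨hf, hS⟩, haS⟩ := h
  refine ⟨_, ⟨hf.preimage (MulAction.injective π⁻¹).injOn, supports_smul π hS⟩, ?_⟩
  simpa using haS

theorem supp_finite {X : NomSet V} (x : X) : (supp x).Finite := by
  obtain ⟨S, hf, hS⟩ := X.finitelySupported x
  exact hf.subset (Set.sInter_subset_of_mem ⟨hf, hS⟩)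

theorem supp_map_subset {X Y : NomSet V} (f : Hom X Y) (x : X) : supp (f x) ⊆ supp x := by
  refine Set.sInter_subset_sInter ?_
  rintro S ⟨hf, hS⟩
  refine ⟨hf, fun g hg => ?_⟩
  rw [← map_smul, hS g hg]

/-- Transposing two fresh names does nothing. -/
theorem transp_smul_of_fresh [Infinite V] {X : NomSet V} {x : X} {a b : V}
    (ha : a ∉ supp x) (hb : b ∉ supp x) : transp a b • x = x := by
  simp only [supp, Set.mem_sInter, not_forall] at ha hb
  obtain ⟨S, ⟨hfS, hS⟩, haS⟩ := ha
  obtain ⟨T, ⟨hfT, hT⟩, hbT⟩ := hb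
  obtain ⟨c, hc⟩ := ((hfS.union hfT).union (Set.toFinite {a, b})).exists_notMem
  simp only [Set.mem_union, Set.mem_insert_iff, Set.mem_singleton_iff, not_or] at hc
  obtain ⟨⟨hcS, hcT⟩, hca, hcb⟩ := hc
  have h1 : transp a c • x = x := by
    refine hS _ fun y hy => ?_
    exact Equiv.swap_apply_of_ne_of_ne (fun h => haS (h ▸ hy)) (fun h => hcS (h ▸ hy))
  have h2 : transp b c • x = x := by
    refine hT _ fun y hy => ?_
    exact Equiv.swap_apply_of_ne_of_ne (fun h => hbT (h ▸ hy)) (fun h => hcT (h ▸ hy))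
  by_cases hab : a = b
  · subst hab
    have : transp a a = (1 : NamePerm V) := Subtype.ext (Equiv.swap_self a)
    rw [this, one_smul]
  · have h3 := transp_conj (transp a c) b c
    have e1 : transp a c • b = b := by
      simpa using Equiv.swap_apply_of_ne_of_ne (Ne.symm hab) (Ne.symm hcb)
    have e2 : transp a c • c = a := by simp
    rw [e1, e2] at h3
    have h4 : (transp a c * transp b c) • x = x := by rw [mul_smul, h2, h1]
    rw [h3, mul_smul, h1] at h4
    have e3 : transp a b = transp b a := Subtype.ext (Equiv.swap_comm a b)
    rw [e3, h4]

end Helpers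

/-! Abstraction `[V]X`. -/

/-- The relation `∼α` on `V × X`: `(x₁, u₁) ∼α (x₂, u₂)` when `(x₁ z) · u₁ = (x₂ z) · u₂` for
some name `z` fresh for `x₁, u₁, x₂, u₂`. -/
def AlphaRel {V : Type u} [DecidableEq V] (X : NomSet V) (a b : V × X) : Prop :=
  ∃ z : V, z ≠ a.1 ∧ z ∉ supp a.2 ∧ z ≠ b.1 ∧ z ∉ supp b.2 ∧
    transp a.1 z • a.2 = transp b.1 z • b.2

theorem exists_fresh {V : Type u} [DecidableEq V] [Infinite V] {X : NomSet V}
    (a b c : V × X) :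
    ∃ z : V, (z ≠ a.1 ∧ z ∉ supp a.2) ∧ (z ≠ b.1 ∧ z ∉ supp b.2) ∧
      (z ≠ c.1 ∧ z ∉ supp c.2) := by
  obtain ⟨z, hz⟩ := (((supp_finite a.2).union (supp_finite b.2)).union
    ((supp_finite c.2).union (Set.toFinite {a.1, b.1, c.1}))).exists_notMem
  simp only [Set.mem_union, Set.mem_insert_iff, Set.mem_singleton_iff, not_or] at hz
  exact ⟨z, ⟨hz.2.2.1, hz.1.1⟩, ⟨hz.2.2.2.1, hz.1.2⟩, ⟨hz.2.2.2.2, hz.2.1⟩⟩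

theorem transp_rename {V : Type u} [DecidableEq V] [Infinite V] {X : NomSet V} {x z w : V}
    {v : X} (hz : z ≠ x ∧ z ∉ supp v) (hw : w ≠ x ∧ w ∉ supp v) :
    transp z w • transp x z • v = transp x w • v := by
  rw [← mul_smul, transp_conj, mul_smul, transp_smul_of_fresh hz.2 hw.2]
  have e1 : transp z w • x = x := by
    simpa using Equiv.swap_apply_of_ne_of_ne (Ne.symm hz.1) (Ne.symm hw.1)
  have e2 : transp z w • z = w := by simp
  rw [e1, e2]

/-- `AlphaRel` as an equivalence relation. -/
def alphaSetoid {V : Type u} [DecidableEq V] [Infinite V] (X : NomSet V) : Setoid (V × X) where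
  r := AlphaRel X
  iseqv :=
    { refl := fun a => by
        obtain ⟨z, h, -, -⟩ := exists_fresh a a a
        exact ⟨z, h.1, h.2, h.1, h.2, rfl⟩
      symm := by
        rintro a b ⟨z, h1, h2, h3, h4, h⟩
        exact ⟨z, h3, h4, h1, h2, h.symm⟩
      trans := by
        rintro a b c ⟨z, h1, h2, h3, h4, h⟩ ⟨z', h1', h2', h3', h4', h'⟩
        obtain ⟨w, hwa, hwb, hwc⟩ := exists_fresh a b c
        refine ⟨w, hwa.1, hwa.2, hwc.1, hwc.2, ?_⟩
        rw [← transp_rename ⟨h1, h2⟩ hwa, h, transp_rename ⟨h3, h4⟩ hwb,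
          ← transp_rename ⟨h1', h2'⟩ hwb, h', transp_rename ⟨h3', h4'⟩ hwc] }

/-- The action `π · ⟨x⟩u = ⟨π · x⟩(π · u)` on `α`-classes. -/
@[reducible] def absAction {V : Type u} [DecidableEq V] [Infinite V] (X : NomSet V) :
    MulAction (NamePerm V) (Quotient (alphaSetoid X)) where
  smul π := Quotient.map (fun a => (π • a.1, π • a.2)) (by
    rintro a b ⟨z, h1, h2, h3, h4, h⟩
    refine ⟨π • z, (MulAction.injective π).ne h1, supp_smul_subset π h2,
      (MulAction.injective π).ne h3, supp_smul_subset π h4, ?_⟩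
    change transp (π • a.1) (π • z) • π • a.2 = transp (π • b.1) (π • z) • π • b.2
    rw [← mul_smul, ← mul_smul, ← transp_conj, ← transp_conj, mul_smul, mul_smul, h])
  one_smul := by
    rintro ⟨a⟩
    exact congrArg (Quotient.mk (alphaSetoid X)) (one_smul (NamePerm V) a)
  mul_smul := by
    rintro π ρ ⟨a⟩
    exact congrArg (Quotient.mk (alphaSetoid X)) (mul_smul π ρ a)

namespace NomSet

variable (V : Type u) [DecidableEq V]

/-- The nominal set of names. -/
def names : NomSet V where
  carrier := V
  finitelySupported x := ⟨{x}, Set.finite_singleton x, fun _ hg => hg rfl⟩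

/-- The terminal nominal set `1`. -/
def one : NomSet V where
  carrier := PUnit.{u + 1}
  finitelySupported _ := ⟨∅, Set.finite_empty, fun _ _ => rfl⟩

variable {V}

/-- The product `X × Y`, with the componentwise action. -/
def prod (X Y : NomSet V) : NomSet V where
  carrier := X × Y
  finitelySupported := by
    rintro ⟨x, y⟩
    obtain ⟨S, hf, hS⟩ := X.finitelySupported x
    obtain ⟨T, hf', hT⟩ := Y.finitelySupported y
    exact ⟨S ∪ T, hf.union hf', fun g hg =>
      Prod.ext (hS g fun _ ha => hg (Or.inl ha)) (hT g fun _ ha => hg (Or.inr ha))⟩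

/-- The coproduct `∐ᵢ Xᵢ`. -/
def coprod {ι : Type u} (X : ι → NomSet V) : NomSet V where
  carrier := Σ i, X i
  finitelySupported := by
    rintro ⟨i, x⟩
    obtain ⟨S, hf, hS⟩ := (X i).finitelySupported x
    exact ⟨S, hf, fun g hg => congrArg (Sigma.mk i) (hS g hg)⟩

/-- The abstraction `[V]X = (V × X)/∼α`. -/
def abs [Infinite V] (X : NomSet V) : NomSet V where
  carrier := Quotient (alphaSetoid X)
  action := absAction X
  finitelySupported := by
    rintro ⟨a⟩
    obtain ⟨S, hf, hS⟩ := ((names V).prod X).finitelySupported a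
    exact ⟨S, hf, fun g hg => congrArg (Quotient.mk (alphaSetoid X)) (hS g hg)⟩

end NomSet

section Maps

variable {V : Type u} [DecidableEq V]

/-- The unique map `X → 1`. -/
def bang (X : NomSet V) : Hom X (NomSet.one V) where
  toFun _ := PUnit.unit
  map_smul' _ _ := rfl

/-- `f × g`. -/
def prodMap {X X' Y Y' : NomSet V} (f : Hom X X') (g : Hom Y Y') :
    Hom (X.prod Y) (X'.prod Y') where
  toFun a := (f a.1, g a.2)
  map_smul' π a := Prod.ext (map_smul f π a.1) (map_smul g π a.2)

/-- `∐ᵢ fᵢ`. -/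
def coprodMap {ι : Type u} {X Y : ι → NomSet V} (f : ∀ i, Hom (X i) (Y i)) :
    Hom (NomSet.coprod X) (NomSet.coprod Y) where
  toFun a := ⟨a.1, f a.1 a.2⟩
  map_smul' π a := congrArg (Sigma.mk a.1) (map_smul (f a.1) π a.2)

variable [Infinite V]

/-- `[V]f : ⟨x⟩u ↦ ⟨x⟩f(u)`. -/
def absMap {X Y : NomSet V} (f : Hom X Y) : Hom X.abs Y.abs where
  toFun := Quotient.map (sa := alphaSetoid X) (sb := alphaSetoid Y) (fun a => (a.1, f a.2)) (by
    rintro a b ⟨z, h1, h2, h3, h4, h⟩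
    refine ⟨z, h1, fun hz => h2 (supp_map_subset f _ hz), h3,
      fun hz => h4 (supp_map_subset f _ hz), ?_⟩
    change transp a.1 z • f a.2 = transp b.1 z • f b.2
    rw [← map_smul, ← map_smul, h])
  map_smul' π a := by
    obtain ⟨a⟩ := a
    exact congrArg (fun w => Quotient.mk (alphaSetoid Y) (π • a.1, w)) (map_smul f π a.2)

/-- `θ : V × X → [V]X`, `(x, u) ↦ ⟨x⟩u`. -/
def theta (X : NomSet V) : Hom ((NomSet.names V).prod X) X.abs where
  toFun a := Quotient.mk (alphaSetoid X) a
  map_smul' _ _ := rfl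

end Maps

/-! Functors built from a grammar. -/

/-- Expressions of the grammar `F ::= V | K | Id | ∐ F | F × F | [V]F`, where `K` is an arbitrary
nominal set. -/
inductive FunctorExpr (V : Type u) [DecidableEq V] : Type (u + 1)
  | names : FunctorExpr V
  | const (K : NomSet V) : FunctorExpr V
  | id : FunctorExpr V
  | coprod (ι : Type u) (F : ι → FunctorExpr V) : FunctorExpr V
  | prod (F G : FunctorExpr V) : FunctorExpr V
  | abs (F : FunctorExpr V) : FunctorExpr V

namespace FunctorExpr

variable {V : Type u} [DecidableEq V]

/-- Replace all occurrences of `[V](-)` by `V × (-)`: if `E` denotes `F_α`, then `E.raw`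
denotes `F`. -/
def raw : FunctorExpr V → FunctorExpr V
  | names => names
  | const K => const K
  | id => id
  | coprod ι F => coprod ι fun i => (F i).raw
  | prod F G => prod F.raw G.raw
  | abs F => prod names F.raw

variable [Infinite V]

/-- The denoted functor, on objects. -/
def obj : FunctorExpr V → NomSet V → NomSet V
  | names, _ => NomSet.names V
  | const K, _ => K
  | id, X => X
  | coprod _ F, X => NomSet.coprod fun i => (F i).obj X
  | prod F G, X => (F.obj X).prod (G.obj X)
  | abs F, X => (F.obj X).abs

/-- The denoted functor, on equivariant maps. -/
def map : (E : FunctorExpr V) → {X Y : NomSet V} → Hom X Y → Hom (E.obj X) (E.obj Y)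
  | names, _, _, _ => MulActionHom.id _
  | const _, _, _, _ => MulActionHom.id _
  | id, _, _, f => f
  | coprod _ F, _, _, f => coprodMap fun i => (F i).map f
  | prod F G, _, _, f => prodMap (F.map f) (G.map f)
  | abs F, _, _, f => absMap (F.map f)

/-- The natural transformation `q : F → F_α` induced by `θ`. -/
def quot : (E : FunctorExpr V) → (X : NomSet V) → Hom (E.raw.obj X) (E.obj X)
  | names, _ => MulActionHom.id _
  | const _, _ => MulActionHom.id _
  | id, _ => MulActionHom.id _
  | coprod _ F, X => coprodMap fun i => (F i).quot X
  | prod F G, X => prodMap (F.quot X) (G.quot X)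
  | abs F, X => (theta (F.obj X)).comp (prodMap (MulActionHom.id _) (F.quot X))

/-- `Fⁿ1`. -/
def iter (E : FunctorExpr V) : ℕ → NomSet V
  | 0 => NomSet.one V
  | n + 1 => E.obj (E.iter n)

/-- The connecting map `Fⁿ⁺¹1 → Fⁿ1` of the final chain, `Fⁿ(!)` with `! : F1 → 1`. -/
def chainMap (E : FunctorExpr V) : (n : ℕ) → Hom (E.iter (n + 1)) (E.iter n)
  | 0 => bang _
  | n + 1 => E.map (E.chainMap n)

/-- The `α`-quotient map `[-]_αⁿ : Fⁿ1 → F_αⁿ1`, given by `[-]_α⁰ = id` and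
`[-]_αⁿ⁺¹ = q ∘ F([-]_αⁿ)`. -/
def alphaMap (E : FunctorExpr V) : (n : ℕ) → Hom (E.raw.iter n) (E.iter n)
  | 0 => MulActionHom.id _
  | n + 1 => (E.quot (E.iter n)).comp (E.raw.map (E.alphaMap n))

end FunctorExpr

/-! Safe elements and safe squares. -/

section Safe

variable {V : Type u} [DecidableEq V]

/-- `u` is `f`-safe when `|supp u| = max {|supp v| : v ∈ f⁻¹(f(u))}`; in particular the maximum
exists. -/
def IsSafe {X Y : NomSet V} (f : Hom X Y) (u : X) : Prop :=
  IsGreatest {n : ℕ | ∃ v : X, f v = f u ∧ (supp v).ncard = n} (supp u).ncard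

/-- The bound variables of `u` relative to `f`. -/
def bv {X Y : NomSet V} (f : Hom X Y) (u : X) : Set V := supp u \ supp (f u)

/-- The square
```
  X ←p─ Z
  │f    │g
  ↓     ↓
  W ←q─ Y
```
commutes and is a safe square. -/
structure IsSafeSquare {X Z W Y : NomSet V}
    (p : Hom Z X) (f : Hom X W) (g : Hom Z Y) (q : Hom Y W) : Prop where
  comm : ∀ z : Z, f (p z) = q (g z)
  lift : ∀ (u : X) (v : Y), IsSafe f u → f u = q v → Disjoint (bv f u) (supp v) →
    ∃ z : Z, IsSafe g z ∧ p z = u ∧ g z = v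

end Safe

end NomSquare

/-! The proof is by induction on `n`. The inductive step holds because every functor of the grammar
carries safe squares to safe squares (`isSafeSquare_map`), by structural induction on the
expression; products and abstractions are the cases with content.

For products, a pair is safe exactly when both components are safe and the bound names of each are
fresh for the other (`isSafe_prodMap`, `IsSafe.left`): bound names can be renamed inside a fibre, so
a largest support has no avoidable clash. Lifts of the two components are renamed apart before they
are paired (`IsSafeSquare.lift_fresh`).

For abstractions, fibres of `theta` lie in orbits, on which the size of the support is constant, so
composing with `theta` does not affect safety. The abstracted name is bound, hence fresh for the
element to be lifted, which can therefore be written with the same abstracted name. What remains is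
a product with an identity square on names.

For `n = 0` the square lies over `1`, and lifting means that every element of `F_α 1` has a safe
preimage (`exists_isSafe_quot_map`). -/

namespace NomSquare

/-! ### Elements of products, coproducts and abstractions -/

section Constructors

variable {V : Type u} [DecidableEq V]

/-- A name, as an element of the nominal set of names. -/
def name (x : V) : NomSet.names V := x

/-- The pair `(x, y)`, as an element of the product. -/
def pair {X Y : NomSet V} (x : X) (y : Y) : X.prod Y := (x, y)

/-- The inclusion of a summand into the coproduct. -/
def inj {ι : Type u} {X : ι → NomSet V} (i : ι) (x : X i) : NomSet.coprod X := ⟨i, x⟩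

theorem exists_pair {X Y : NomSet V} (a : X.prod Y) : ∃ (x : X) (y : Y), pair x y = a :=
  ⟨a.1, a.2, rfl⟩

theorem exists_name_pair {X : NomSet V} (a : (NomSet.names V).prod X) :
    ∃ (x : V) (u : X), pair (name x) u = a :=
  ⟨a.1, a.2, rfl⟩

theorem exists_inj {ι : Type u} {X : ι → NomSet V} (a : NomSet.coprod X) :
    ∃ (i : ι) (x : X i), inj i x = a :=
  ⟨a.1, a.2, rfl⟩

theorem pair_inj {X Y : NomSet V} {x x' : X} {y y' : Y} :
    pair x y = pair x' y' ↔ x = x' ∧ y = y' :=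
  Prod.mk_inj

theorem inj_injective {ι : Type u} {X : ι → NomSet V} (i : ι) :
    Function.Injective (inj (X := X) i) :=
  fun _ _ h => eq_of_heq (Sigma.mk.inj h).2

theorem prodMap_pair {X X' Y Y' : NomSet V} (f : Hom X X') (g : Hom Y Y') (x : X) (y : Y) :
    prodMap f g (pair x y) = pair (f x) (g y) := rfl

theorem coprodMap_inj {ι : Type u} {X Y : ι → NomSet V} (f : ∀ i, Hom (X i) (Y i)) (i : ι)
    (x : X i) : coprodMap f (inj i x) = inj i (f i x) := rfl

/-- The abstraction `⟨x⟩u`. -/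
def bind [Infinite V] {X : NomSet V} (x : V) (u : X) : X.abs := theta X (pair (name x) u)

theorem smul_bind [Infinite V] {X : NomSet V} (π : NamePerm V) (x : V) (u : X) :
    π • bind x u = bind (π • x) (π • u) := rfl

end Constructors

/-! ### Supports and renaming -/

section Support

variable {V : Type u} [DecidableEq V]

theorem mem_supp_smul {X : NomSet V} {x : X} (π : NamePerm V) {a : V} :
    a ∈ supp (π • x) ↔ π⁻¹ • a ∈ supp x := by
  constructor
  · intro h
    by_contra hn
    exact supp_smul_subset π hn (by rwa [smul_inv_smul])
  · intro h
    by_contra hn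
    exact supp_smul_subset π⁻¹ hn (by rwa [inv_smul_smul])

theorem supp_smul {X : NomSet V} (x : X) (π : NamePerm V) :
    supp (π • x) = (fun a => π • a) '' supp x := by
  ext a
  rw [mem_supp_smul]
  constructor
  · exact fun h => ⟨_, h, smul_inv_smul π a⟩
  · rintro ⟨b, hb, rfl⟩
    simpa using hb

theorem ncard_supp_smul {X : NomSet V} (x : X) (π : NamePerm V) :
    (supp (π • x)).ncard = (supp x).ncard := by
  rw [supp_smul, Set.ncard_image_of_injective _ (MulAction.injective π)]

theorem notMem_supp {X : NomSet V} {x : X} {a : V} :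
    a ∉ supp x ↔ ∃ S : Set V, (S.Finite ∧ MulAction.Supports (NamePerm V) S x) ∧ a ∉ S := by
  simp only [supp, Set.mem_sInter, not_forall, Set.mem_ofPred_eq, exists_prop]

theorem supp_pair {X Y : NomSet V} (x : X) (y : Y) : supp (pair x y) = supp x ∪ supp y := by
  refine subset_antisymm (fun b hb => ?_) (Set.union_subset ?_ ?_)
  · by_contra h
    simp only [Set.mem_union, not_or] at h
    obtain ⟨S, ⟨hf, hS⟩, hbS⟩ := notMem_supp.1 h.1
    obtain ⟨T, ⟨hf', hT⟩, hbT⟩ := notMem_supp.1 h.2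
    refine notMem_supp.2 ⟨S ∪ T, ⟨hf.union hf', fun g hg => ?_⟩, ?_⟩ hb
    · exact Prod.ext (hS g fun _ ha => hg (Or.inl ha)) (hT g fun _ ha => hg (Or.inr ha))
    · simp [hbS, hbT]
  · let f : Hom (X.prod Y) X := { toFun := fun a => a.1, map_smul' := fun _ _ => rfl }
    exact supp_map_subset f (pair x y)
  · let f : Hom (X.prod Y) Y := { toFun := fun a => a.2, map_smul' := fun _ _ => rfl }
    exact supp_map_subset f (pair x y)

theorem supp_inj {ι : Type u} {X : ι → NomSet V} (i : ι) (x : X i) :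
    supp (inj (X := X) i x) = supp x := by
  refine subset_antisymm ?_ ?_
  · let f : Hom (X i) (NomSet.coprod X) := { toFun := inj i, map_smul' := fun _ _ => rfl }
    exact supp_map_subset f x
  · refine Set.sInter_subset_sInter ?_
    rintro S ⟨hf, hS⟩
    exact ⟨hf, fun g hg => inj_injective i (hS g hg)⟩

variable [Infinite V]

theorem supp_name (x : V) : supp (name x) = {x} := by
  refine subset_antisymm (Set.sInter_subset_of_mem
    ⟨Set.finite_singleton _, fun _ hg => hg rfl⟩) ?_
  rw [Set.singleton_subset_iff]
  rintro S ⟨hf, hS⟩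
  by_contra hx
  obtain ⟨b, hb⟩ := (hf.insert x).exists_notMem
  simp only [Set.mem_insert_iff, not_or] at hb
  refine hb.1 ?_
  have h := hS (transp x b) fun y hy =>
    Equiv.swap_apply_of_ne_of_ne (fun h => hx (h ▸ hy)) (fun h => hb.2 (h ▸ hy))
  exact (Equiv.swap_apply_left x b).symm.trans h

/-- Names outside `A` can be moved away from `B` without changing anything supported in `A`. -/
theorem exists_refresh {S A B : Set V} (hS : S.Finite) (hA : A.Finite) (hB : B.Finite) :
    ∃ π : NamePerm V, (∀ a ∈ A, π • a = a) ∧ (∀ a ∈ S, a ∉ A → π • a ∉ B) ∧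
      ∀ (X : NomSet V) (x : X), supp x ⊆ A → π • x = x := by
  induction S, hS using Set.Finite.induction_on with
  | empty => exact ⟨1, by simp, by simp, by simp⟩
  | @insert a S haS hS ih =>
    obtain ⟨π, h1, h2, h3⟩ := ih
    by_cases ha : a ∈ A
    · refine ⟨π, h1, ?_, h3⟩
      rintro b (rfl | hb) hbA
      exacts [absurd ha hbA, h2 b hb hbA]
    -- Avoiding the image of `S` keeps the swap of `π • a` with `c` from disturbing names already
    -- moved.
    obtain ⟨c, hc⟩ := ((hA.union hB).union (hS.image fun s => π • s)).exists_notMem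
    simp only [Set.mem_union, not_or] at hc
    obtain ⟨⟨hcA, hcB⟩, hcS⟩ := hc
    have hπ : π • a ∉ A := fun h => ha (by
      rwa [← MulAction.injective π (h1 _ h)])
    refine ⟨transp (π • a) c * π, fun b hb => ?_, fun b hb hbA => ?_, fun X x hx => ?_⟩
    · rw [mul_smul, h1 b hb, transp_smul]
      exact Equiv.swap_apply_of_ne_of_ne (fun h => hπ (h ▸ hb)) (fun h => hcA (h ▸ hb))
    · rw [mul_smul, transp_smul]
      by_cases hba : b = a
      · rw [hba, Equiv.swap_apply_left]
        exact hcB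
      · have hb' : b ∈ S := hb.resolve_left hba
        rw [Equiv.swap_apply_of_ne_of_ne ((MulAction.injective π).ne hba)
          (fun h => hcS ⟨b, hb', h⟩)]
        exact h2 b hb' hbA
    · rw [mul_smul, h3 X x hx]
      exact transp_smul_of_fresh (fun h => hπ (hx h)) (fun h => hcA (hx h))

/-- The bound names of `z` can be refreshed: away from `A`, the support of the renamed element
avoids `B`. -/
theorem exists_smul_refresh {Z : NomSet V} (z : Z) {A B : Set V} (hA : A.Finite)
    (hB : B.Finite) :
    ∃ π : NamePerm V, (∀ a ∈ supp (π • z), a ∈ B → a ∈ A) ∧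
      ∀ (X : NomSet V) (x : X), supp x ⊆ A → π • x = x := by
  obtain ⟨π, h1, h2, h3⟩ := exists_refresh (supp_finite z) hA hB
  refine ⟨π, fun a ha haB => ?_, h3⟩
  rw [supp_smul] at ha
  obtain ⟨b, hb, rfl⟩ := ha
  by_contra hn
  exact h2 b hb (fun hbA => hn (by simpa only [h1 b hbA] using hbA)) haB

end Support

/-! ### Supports and representatives of abstractions -/

section Abstraction

variable {V : Type u} [DecidableEq V] [Infinite V]

theorem exists_bind {X : NomSet V} (v : X.abs) : ∃ (x : V) (u : X), bind x u = v := by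
  obtain ⟨⟨x, u⟩, rfl⟩ := Quotient.mk_surjective v
  exact ⟨x, u, rfl⟩

theorem alphaRel_of_theta_eq {X : NomSet V} {a b : (NomSet.names V).prod X}
    (h : theta X a = theta X b) : AlphaRel X a b :=
  Quotient.exact (s := alphaSetoid X) h

theorem bind_right_injective {X : NomSet V} {x : V} {u v : X}
    (h : bind x u = bind x v) : u = v := by
  obtain ⟨z, -, -, -, -, h⟩ := alphaRel_of_theta_eq h
  exact MulAction.injective _ h

/-- The fibres of `θ` are contained in orbits. -/
theorem exists_smul_eq_of_theta_eq {X : NomSet V} {a b : (NomSet.names V).prod X}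
    (h : theta X a = theta X b) : ∃ π : NamePerm V, π • a = b := by
  obtain ⟨x, u, rfl⟩ := exists_name_pair a
  obtain ⟨y, v, rfl⟩ := exists_name_pair b
  obtain ⟨z, -, -, -, -, h⟩ := alphaRel_of_theta_eq h
  refine ⟨(transp y z)⁻¹ * transp x z, ?_⟩
  rw [mul_smul, inv_smul_eq_iff]
  exact pair_inj.2 ⟨(Equiv.swap_apply_left x z).trans (Equiv.swap_apply_left y z).symm, h⟩

theorem supp_bind_subset {X : NomSet V} (x : V) (u : X) :
    supp (bind x u) ⊆ insert x (supp u) := by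
  refine (supp_map_subset (theta X) _).trans ?_
  rw [supp_pair, supp_name, Set.singleton_union]

/-- Swapping `x` with a fresh `c` fixes the class, so `x` in its support would put `c` there too. -/
theorem notMem_supp_bind {X : NomSet V} (x : V) (u : X) : x ∉ supp (bind x u) := by
  obtain ⟨c, ⟨hcx, hcu⟩, -, -⟩ := exists_fresh (X := X) (x, u) (x, u) (x, u)
  have hc : c ∉ supp (bind x u) := fun h => by
    rcases supp_bind_subset x u h with h | h
    exacts [hcx h, hcu h]
  obtain ⟨z, ⟨hzx, hzu⟩, ⟨hzc, hzu'⟩, -⟩ :=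
    exists_fresh (X := X) (x, u) (c, transp x c • u) (x, u)
  have h : bind x u = transp x c • bind x u := by
    rw [smul_bind]
    have e : transp x c • x = c := by simp
    rw [e]
    refine Quotient.sound (s := alphaSetoid X) ⟨z, hzx, hzu, hzc, hzu', ?_⟩
    exact (transp_rename ⟨hcx, hcu⟩ ⟨hzx, hzu⟩).symm
  rw [h, mem_supp_smul]
  have e : (transp x c)⁻¹ • x = c := by rw [inv_smul_eq_iff]; simp
  rwa [e]

/-- If `a ≠ x` is fresh for the class, swapping it with a fresh `c` fixes both the class and `x`,
hence `u`; then `a ∈ supp u` would force `c ∈ supp u`. -/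
theorem supp_subset_insert_supp_bind {X : NomSet V} (x : V) (u : X) :
    supp u ⊆ insert x (supp (bind x u)) := by
  intro a ha
  by_contra h
  simp only [Set.mem_insert_iff, not_or] at h
  obtain ⟨c, ⟨hcx, hcu⟩, ⟨hca, -⟩, -⟩ := exists_fresh (X := X) (x, u) (a, u) (x, u)
  have hc : c ∉ supp (bind x u) := fun h => by
    rcases supp_bind_subset x u h with h | h
    exacts [hcx h, hcu h]
  have h1 := transp_smul_of_fresh h.2 hc
  rw [smul_bind] at h1
  have e : transp a c • x = x := Equiv.swap_apply_of_ne_of_ne (Ne.symm h.1) (Ne.symm hcx)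
  rw [e] at h1
  have h2 := bind_right_injective h1
  rw [← h2, mem_supp_smul] at ha
  have e : (transp a c)⁻¹ • a = c := by rw [inv_smul_eq_iff]; simp
  rw [e] at ha
  exact hcu ha

theorem exists_bind_eq {X : NomSet V} {x : V} {v : X.abs} (hx : x ∉ supp v) :
    ∃ u : X, bind x u = v := by
  obtain ⟨y, w, rfl⟩ := exists_bind v
  refine ⟨transp x y • w, ?_⟩
  rw [← transp_smul_of_fresh hx (notMem_supp_bind y w), smul_bind]
  have e : transp x y • y = x := by simp
  rw [e]

end Abstraction

/-! ### Safe elements under coproducts, products and `theta` -/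

section SafeElements

variable {V : Type u} [DecidableEq V]

theorem isSafe_iff {X Y : NomSet V} {f : Hom X Y} {u : X} :
    IsSafe f u ↔ ∀ v : X, f v = f u → (supp v).ncard ≤ (supp u).ncard := by
  constructor
  · exact fun h v hv => h.2 ⟨v, hv, rfl⟩
  · refine fun h => ⟨⟨u, rfl, rfl⟩, ?_⟩
    rintro _ ⟨v, hv, rfl⟩
    exact h v hv

theorem isSafe_of_injective {X Y : NomSet V} {f : Hom X Y} (hf : Function.Injective f) (u : X) :
    IsSafe f u :=
  isSafe_iff.2 fun _ hv => by rw [hf hv]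

theorem IsSafe.smul {X Y : NomSet V} {f : Hom X Y} {u : X} (h : IsSafe f u) (π : NamePerm V) :
    IsSafe f (π • u) := by
  refine isSafe_iff.2 fun v hv => ?_
  rw [ncard_supp_smul, ← ncard_supp_smul v π⁻¹]
  refine isSafe_iff.1 h _ ?_
  rw [map_smul, hv, map_smul, inv_smul_smul]

theorem isSafe_coprodMap {ι : Type u} {X Y : ι → NomSet V} {f : ∀ i, Hom (X i) (Y i)} {i : ι}
    {u : X i} : IsSafe (coprodMap f) (inj i u) ↔ IsSafe (f i) u := by
  rw [isSafe_iff, isSafe_iff]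
  constructor
  · intro h v hv
    have := h (inj i v) (congrArg (inj i) hv)
    rwa [supp_inj, supp_inj] at this
  · intro h w hv
    obtain ⟨j, v, rfl⟩ := exists_inj w
    obtain rfl : j = i := congrArg Sigma.fst hv
    rw [supp_inj, supp_inj]
    exact h v (inj_injective j hv)

/-- Pairs of safe elements whose bound names are fresh for the other component are safe. -/
theorem isSafe_prodMap {X₁ Y₁ X₂ Y₂ : NomSet V} {f₁ : Hom X₁ Y₁} {f₂ : Hom X₂ Y₂} {u₁ : X₁}
    {u₂ : X₂} (h₁ : IsSafe f₁ u₁) (h₂ : IsSafe f₂ u₂) (h₁₂ : Disjoint (bv f₁ u₁) (supp u₂))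
    (h₂₁ : Disjoint (bv f₂ u₂) (supp u₁)) : IsSafe (prodMap f₁ f₂) (pair u₁ u₂) := by
  refine isSafe_iff.2 ?_
  intro v hv
  obtain ⟨v₁, v₂, rfl⟩ := exists_pair v
  obtain ⟨e₁, e₂⟩ : f₁ v₁ = f₁ u₁ ∧ f₂ v₂ = f₂ u₂ := pair_inj.1 hv
  have c₁ := isSafe_iff.1 h₁ v₁ e₁
  have c₂ := isSafe_iff.1 h₂ v₂ e₂
  have s₁ := supp_map_subset f₁ u₁
  have s₂ := supp_map_subset f₂ u₂
  have t₁ := supp_map_subset f₁ v₁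
  have t₂ := supp_map_subset f₂ v₂
  rw [e₁] at t₁
  rw [e₂] at t₂
  have hw := (supp_finite (f₁ u₁)).union (supp_finite (f₂ u₂))
  have hb₁ : (bv f₁ u₁).Finite := (supp_finite u₁).sdiff
  have hb₂ : (bv f₂ u₂).Finite := (supp_finite u₂).sdiff
  have k₁ := Set.ncard_sdiff_add_ncard_of_subset s₁ (supp_finite u₁)
  have k₂ := Set.ncard_sdiff_add_ncard_of_subset s₂ (supp_finite u₂)
  have l₁ := Set.ncard_sdiff_add_ncard_of_subset t₁ (supp_finite v₁)
  have l₂ := Set.ncard_sdiff_add_ncard_of_subset t₂ (supp_finite v₂)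
  have hu : supp u₁ ∪ supp u₂ = (supp (f₁ u₁) ∪ supp (f₂ u₂)) ∪ (bv f₁ u₁ ∪ bv f₂ u₂) := by
    ext a
    have := @s₁ a
    have := @s₂ a
    simp only [bv, Set.mem_union, Set.mem_sdiff]
    tauto
  have hv' : supp v₁ ∪ supp v₂ ⊆ (supp (f₁ u₁) ∪ supp (f₂ u₂)) ∪
      ((supp v₁ \ supp (f₁ u₁)) ∪ (supp v₂ \ supp (f₂ u₂))) := by
    intro a
    simp only [Set.mem_union, Set.mem_sdiff]
    tauto
  -- Disjointness makes the count for `u` exact, while for `v` the union bound suffices.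
  have d₁ : Disjoint (bv f₁ u₁) (bv f₂ u₂) := h₁₂.mono_right Set.sdiff_subset
  have d₂ : Disjoint (supp (f₁ u₁) ∪ supp (f₂ u₂)) (bv f₁ u₁ ∪ bv f₂ u₂) := by
    rw [Set.disjoint_union_left, Set.disjoint_union_right, Set.disjoint_union_right]
    exact ⟨⟨Set.disjoint_sdiff_right, (h₂₁.mono_right s₁).symm⟩,
      (h₁₂.mono_right s₂).symm, Set.disjoint_sdiff_right⟩
  rw [supp_pair, supp_pair, hu, Set.ncard_union_eq d₂ hw (hb₁.union hb₂), Set.ncard_union_eq d₁ hb₁ hb₂]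
  have hle := Set.ncard_le_ncard hv' (hw.union
    ((supp_finite v₁).sdiff.union (supp_finite v₂).sdiff))
  have hle₁ := Set.ncard_union_le (supp (f₁ u₁) ∪ supp (f₂ u₂))
    ((supp v₁ \ supp (f₁ u₁)) ∪ (supp v₂ \ supp (f₂ u₂)))
  have hle₂ := Set.ncard_union_le (supp v₁ \ supp (f₁ u₁)) (supp v₂ \ supp (f₂ u₂))
  change (bv f₁ u₁).ncard + _ = _ at k₁
  change (bv f₂ u₂).ncard + _ = _ at k₂
  omega

theorem IsSafe.prod_swap {X₁ Y₁ X₂ Y₂ : NomSet V} {f₁ : Hom X₁ Y₁} {f₂ : Hom X₂ Y₂} {u₁ : X₁}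
    {u₂ : X₂} (h : IsSafe (prodMap f₁ f₂) (pair u₁ u₂)) : IsSafe (prodMap f₂ f₁) (pair u₂ u₁) := by
  refine isSafe_iff.2 ?_
  intro v hv
  obtain ⟨v₂, v₁, rfl⟩ := exists_pair v
  have := isSafe_iff.1 h (pair v₁ v₂) (pair_inj.2 (pair_inj.1 hv).symm)
  rw [supp_pair, supp_pair] at this ⊢
  rwa [Set.union_comm (supp v₂), Set.union_comm (supp u₂)]

variable [Infinite V]

/-- Any `v₁` in the fibre of `u₁` can be renamed so as to meet `supp u₂` only inside `supp (f₁ u₁)`.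
Comparing the resulting pair with the safe one yields `key`; the case `v₁ = u₁` shows that `u₁`
itself has no other overlap. -/
theorem IsSafe.left {X₁ Y₁ X₂ Y₂ : NomSet V} {f₁ : Hom X₁ Y₁} {f₂ : Hom X₂ Y₂} {u₁ : X₁}
    {u₂ : X₂} (h : IsSafe (prodMap f₁ f₂) (pair u₁ u₂)) :
    IsSafe f₁ u₁ ∧ Disjoint (bv f₁ u₁) (supp u₂) := by
  have key : ∀ v₁ : X₁, f₁ v₁ = f₁ u₁ → (supp v₁).ncard + (supp u₁ ∩ supp u₂).ncard ≤
      (supp u₁).ncard + (supp (f₁ u₁) ∩ supp u₂).ncard := by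
    intro v₁ hv
    obtain ⟨π, h1, h2⟩ := exists_smul_refresh v₁ (supp_finite (f₁ u₁)) (supp_finite u₂)
    have e : f₁ (π • v₁) = f₁ u₁ := by rw [map_smul, hv, h2 _ _ subset_rfl]
    have hle := isSafe_iff.1 h (pair (π • v₁) u₂) (pair_inj.2 ⟨e, rfl⟩)
    rw [supp_pair, supp_pair] at hle
    have k₁ := Set.ncard_union_add_ncard_inter (supp (π • v₁)) (supp u₂) (supp_finite _)
      (supp_finite _)
    have k₂ := Set.ncard_union_add_ncard_inter (supp u₁) (supp u₂) (supp_finite _)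
      (supp_finite _)
    have k₃ : (supp (π • v₁) ∩ supp u₂).ncard ≤ (supp (f₁ u₁) ∩ supp u₂).ncard :=
      Set.ncard_le_ncard (fun a ha => ⟨h1 a ha.1 ha.2, ha.2⟩) ((supp_finite _).inter_of_left _)
    rw [ncard_supp_smul] at k₁
    omega
  have hsub : supp (f₁ u₁) ∩ supp u₂ ⊆ supp u₁ ∩ supp u₂ :=
    Set.inter_subset_inter_left _ (supp_map_subset f₁ u₁)
  have hfin : (supp u₁ ∩ supp u₂).Finite := (supp_finite _).inter_of_left _
  refine ⟨isSafe_iff.2 fun v hv => ?_, ?_⟩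
  · have := key v hv
    have := Set.ncard_le_ncard hsub hfin
    omega
  · have heq := Set.eq_of_subset_of_ncard_le hsub (by have := key u₁ rfl; omega) hfin
    rw [Set.disjoint_left]
    rintro a ⟨ha, hn⟩ ha'
    exact hn (heq.symm ▸ (⟨ha, ha'⟩ : a ∈ supp u₁ ∩ supp u₂) :
      a ∈ supp (f₁ u₁) ∩ supp u₂).1

theorem isSafe_theta_comp {X Y : NomSet V} {f : Hom X ((NomSet.names V).prod Y)} {u : X} :
    IsSafe ((theta Y).comp f) u ↔ IsSafe f u := by
  rw [isSafe_iff, isSafe_iff]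
  constructor
  · exact fun h v hv => h v (congrArg (theta Y) hv)
  · intro h v hv
    -- Renaming by `π` moves `v` into the fibre of `f` without changing the size of its support.
    obtain ⟨π, hπ⟩ := exists_smul_eq_of_theta_eq (X := Y) (a := f v) (b := f u) hv
    rw [← ncard_supp_smul v π]
    exact h _ (by rw [map_smul, hπ])

end SafeElements

/-! ### Closure properties of safe squares -/

section SafeSquares

variable {V : Type u} [DecidableEq V]

theorem isSafeSquare_id {X Y : NomSet V} (f : Hom X Y) :
    IsSafeSquare f (MulActionHom.id _) (MulActionHom.id _) f where
  comm _ := rfl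
  lift _ v _ h _ := ⟨v, isSafe_of_injective (fun _ _ h => h) v, h.symm, rfl⟩

theorem IsSafeSquare.coprod {ι : Type u} {X Z W Y : ι → NomSet V} {p : ∀ i, Hom (Z i) (X i)}
    {f : ∀ i, Hom (X i) (W i)} {g : ∀ i, Hom (Z i) (Y i)} {q : ∀ i, Hom (Y i) (W i)}
    (h : ∀ i, IsSafeSquare (p i) (f i) (g i) (q i)) :
    IsSafeSquare (coprodMap p) (coprodMap f) (coprodMap g) (coprodMap q) where
  comm z := congrArg (Sigma.mk z.1) ((h z.1).comm z.2)
  lift := by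
    intro u v hu hv hd
    obtain ⟨i, u, rfl⟩ := exists_inj u
    obtain ⟨j, v, rfl⟩ := exists_inj v
    obtain rfl : i = j := congrArg Sigma.fst hv
    rw [bv, coprodMap_inj, supp_inj, supp_inj, supp_inj] at hd
    obtain ⟨z, hz, hp, hg⟩ := (h i).lift u v (isSafe_coprodMap.1 hu) (inj_injective i hv) hd
    exact ⟨inj i z, isSafe_coprodMap.2 hz, congrArg (inj i) hp, congrArg (inj i) hg⟩

variable [Infinite V]

/-- In a safe square, the lift can be chosen with new bound names outside a given finite set. -/
theorem IsSafeSquare.lift_fresh {X Z W Y : NomSet V} {p : Hom Z X} {f : Hom X W} {g : Hom Z Y}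
    {q : Hom Y W} (h : IsSafeSquare p f g q) {u : X} {v : Y} (hu : IsSafe f u)
    (hv : f u = q v) (hd : Disjoint (bv f u) (supp v)) {B : Set V} (hB : B.Finite) :
    ∃ z : Z, IsSafe g z ∧ p z = u ∧ g z = v ∧ ∀ a ∈ bv g z, a ∈ B → a ∈ bv f u := by
  obtain ⟨z, hz, rfl, rfl⟩ := h.lift u v hu hv hd
  obtain ⟨π, h1, h2⟩ := exists_smul_refresh z
    ((supp_finite (p z)).union (supp_finite (g z))) hB
  have ep : p (π • z) = p z := by rw [map_smul, h2 _ _ Set.subset_union_left]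
  have eg : g (π • z) = g z := by rw [map_smul, h2 _ _ Set.subset_union_right]
  refine ⟨π • z, hz.smul π, ep, eg, ?_⟩
  rintro a ⟨ha, hn⟩ haB
  rw [eg] at hn
  -- A name of `f u = q v` already lies in `supp v`, so it is not bound in the lift.
  refine ⟨(h1 a ha haB).resolve_right hn, fun hf => hn ?_⟩
  rw [hv] at hf
  exact supp_map_subset q _ hf

theorem IsSafeSquare.prod {X₁ Z₁ W₁ Y₁ X₂ Z₂ W₂ Y₂ : NomSet V} {p₁ : Hom Z₁ X₁} {f₁ : Hom X₁ W₁}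
    {g₁ : Hom Z₁ Y₁} {q₁ : Hom Y₁ W₁} {p₂ : Hom Z₂ X₂} {f₂ : Hom X₂ W₂} {g₂ : Hom Z₂ Y₂}
    {q₂ : Hom Y₂ W₂} (h₁ : IsSafeSquare p₁ f₁ g₁ q₁) (h₂ : IsSafeSquare p₂ f₂ g₂ q₂) :
    IsSafeSquare (prodMap p₁ p₂) (prodMap f₁ f₂) (prodMap g₁ g₂) (prodMap q₁ q₂) where
  comm z := Prod.ext (h₁.comm z.1) (h₂.comm z.2)
  lift := by
    intro u v hu hv hd
    obtain ⟨u₁, u₂, rfl⟩ := exists_pair u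
    obtain ⟨v₁, v₂, rfl⟩ := exists_pair v
    obtain ⟨e₁, e₂⟩ : f₁ u₁ = q₁ v₁ ∧ f₂ u₂ = q₂ v₂ := pair_inj.1 hv
    obtain ⟨hu₁, d₁⟩ := hu.left
    obtain ⟨hu₂, d₂⟩ := hu.prod_swap.left
    have hbv : bv f₁ u₁ ∪ bv f₂ u₂ ⊆ bv (prodMap f₁ f₂) (pair u₁ u₂) := by
      intro a ha
      rw [bv, prodMap_pair, supp_pair, supp_pair]
      rcases ha with ha | ha
      · refine ⟨Or.inl ha.1, ?_⟩
        rintro (h | h)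
        exacts [ha.2 h, Set.disjoint_left.1 d₁ ha (supp_map_subset f₂ _ h)]
      · refine ⟨Or.inr ha.1, ?_⟩
        rintro (h | h)
        exacts [Set.disjoint_left.1 d₂ ha (supp_map_subset f₁ _ h), ha.2 h]
    rw [supp_pair] at hd
    replace hd := hd.mono_left hbv
    rw [Set.disjoint_union_left, Set.disjoint_union_right, Set.disjoint_union_right] at hd
    obtain ⟨⟨d₁₁, d₁₂⟩, d₂₁, d₂₂⟩ := hd
    -- The order matters: `z₁` is chosen away from the data `u₂`, `v₂`, and then `z₂` away from `z₁`
    -- itself.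
    obtain ⟨z₁, hz₁, hp₁, hg₁, hb₁⟩ := h₁.lift_fresh hu₁ e₁ d₁₁
      ((supp_finite u₂).union (supp_finite v₂))
    obtain ⟨z₂, hz₂, hp₂, hg₂, hb₂⟩ := h₂.lift_fresh hu₂ e₂ d₂₂
      ((supp_finite z₁).union (supp_finite v₁))
    have hsub : bv f₁ u₁ ⊆ supp u₁ := Set.sdiff_subset
    have key₂ : Disjoint (bv g₂ z₂) (supp z₁) := by
      rw [Set.disjoint_left]
      intro a ha haz
      have hau := hb₂ a ha (Or.inl haz)
      by_cases hav : a ∈ supp v₁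
      -- A clash comes from a name bound in `u₂`. It is not in `supp v₁` by hypothesis; otherwise it
      -- is bound in `z₁`, hence in `u₁`, against safety of the pair.
      · exact Set.disjoint_left.1 d₂₁ hau hav
      · exact Set.disjoint_left.1 d₂ hau
          (hsub (hb₁ a ⟨haz, by rwa [hg₁]⟩ (Or.inl hau.1)))
    have key₁ : Disjoint (bv g₁ z₁) (supp z₂) := by
      rw [Set.disjoint_left]
      intro a ha haz
      by_cases hav : a ∈ supp v₂
      · exact Set.disjoint_left.1 d₁₂ (hb₁ a ha (Or.inr hav)) hav
      · exact Set.disjoint_left.1 key₂ ⟨haz, by rwa [hg₂]⟩ ha.1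
    exact ⟨pair z₁ z₂, isSafe_prodMap hz₁ hz₂ key₁ key₂, pair_inj.2 ⟨hp₁, hp₂⟩, pair_inj.2 ⟨hg₁, hg₂⟩⟩

/-- Over `1` nothing is bound and everything is safe, so having safe preimages is a safe-square
condition and the product case applies. -/
theorem exists_isSafe_prodMap {X₁ Y₁ X₂ Y₂ : NomSet V} {f₁ : Hom X₁ Y₁} {f₂ : Hom X₂ Y₂}
    (h₁ : ∀ v, ∃ u, IsSafe f₁ u ∧ f₁ u = v) (h₂ : ∀ v, ∃ u, IsSafe f₂ u ∧ f₂ u = v)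
    (v₁ : Y₁) (v₂ : Y₂) : ∃ u, IsSafe (prodMap f₁ f₂) u ∧ prodMap f₁ f₂ u = pair v₁ v₂ := by
  have key : ∀ {X Y : NomSet V} (f : Hom X Y), (∀ v, ∃ u, IsSafe f u ∧ f u = v) →
      IsSafeSquare (bang X) (MulActionHom.id _) f (bang Y) := fun f h =>
    ⟨fun _ => rfl, fun _ v _ _ _ => (h v).imp fun _ h => ⟨h.1, rfl, h.2⟩⟩
  obtain ⟨u, hu, -, hv⟩ := ((key f₁ h₁).prod (key f₂ h₂)).lift
    (pair PUnit.unit PUnit.unit) (pair v₁ v₂) (isSafe_of_injective (fun _ _ h => h) _) rfl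
    (Set.disjoint_left.2 fun _ ha => absurd ha.1 ha.2)
  exact ⟨u, hu, hv⟩

theorem IsSafeSquare.abs {X Z W Y : NomSet V} {p : Hom Z X} {f : Hom X W} {g : Hom Z Y}
    {q : Hom Y W} (h : IsSafeSquare p f g q) :
    IsSafeSquare (prodMap (MulActionHom.id _) p)
      ((theta W).comp (prodMap (MulActionHom.id _) f))
      ((theta Y).comp (prodMap (MulActionHom.id _) g)) (absMap q) where
  comm z := congrArg (fun w => theta W (z.1, w)) (h.comm z.2)
  lift := by
    intro u v hu hv hd
    obtain ⟨x, u, rfl⟩ := exists_name_pair u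
    have hx : x ∈ bv ((theta W).comp (prodMap (MulActionHom.id _) f)) (pair (name x) u) := by
      refine ⟨?_, notMem_supp_bind x (f u)⟩
      rw [supp_pair, supp_name]
      exact Or.inl rfl
    obtain ⟨v, rfl⟩ := exists_bind_eq (Set.disjoint_left.1 hd hx)
    have hv' : f u = q v := bind_right_injective (x := x) hv
    rw [isSafe_theta_comp] at hu
    have hd' : Disjoint (bv (prodMap (MulActionHom.id _) f) (pair (name x) u))
        (supp (pair (name x) v)) := by
      rw [Set.disjoint_left]
      intro a ha hav
      -- `x` occurs in the image of the pair before `theta` is applied, so it is not bound there.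
      have hax : a ≠ x := by
        rintro rfl
        refine ha.2 ?_
        rw [prodMap_pair, supp_pair, MulActionHom.id_apply, supp_name]
        exact Or.inl rfl
      rw [supp_pair, supp_name] at hav
      have hav' : a ∈ supp v := hav.resolve_left hax
      refine Set.disjoint_left.1 hd
        ⟨ha.1, fun h => ha.2 (supp_map_subset (theta W) _ h)⟩ ?_
      exact (supp_subset_insert_supp_bind x v hav').resolve_left hax
    obtain ⟨z, hz, hp, hg⟩ := ((isSafeSquare_id (MulActionHom.id _)).prod h).lift
      (pair (name x) u) (pair (name x) v) hu (pair_inj.2 ⟨rfl, hv'⟩) hd'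
    exact ⟨z, isSafe_theta_comp.2 hz, hp, congrArg (theta Y) hg⟩

end SafeSquares

/-! ### Induction on expressions and along the final chain -/

namespace FunctorExpr

variable {V : Type u} [DecidableEq V] [Infinite V]

theorem isSafeSquare_map (E : FunctorExpr V) {X Z W Y : NomSet V} {p : Hom Z X} {f : Hom X W}
    {g : Hom Z Y} {q : Hom Y W} (h : IsSafeSquare p f g q) :
    IsSafeSquare (E.raw.map p) ((E.quot W).comp (E.raw.map f)) ((E.quot Y).comp (E.raw.map g))
      (E.map q) := by
  induction E with
  | names => exact isSafeSquare_id _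
  | const K => exact isSafeSquare_id _
  | id => exact h
  | coprod ι F ih => exact IsSafeSquare.coprod ih
  | prod F G ihF ihG => exact ihF.prod ihG
  | abs F ih => exact ih.abs

/-- Needed for the start of the chain; general `g` costs nothing in the structural induction. -/
theorem exists_isSafe_quot_map (E : FunctorExpr V) {Z Y : NomSet V} {g : Hom Z Y}
    (h : ∀ v : Y, ∃ z : Z, IsSafe g z ∧ g z = v) (v : E.obj Y) :
    ∃ z : E.raw.obj Z, IsSafe ((E.quot Y).comp (E.raw.map g)) z ∧
      (E.quot Y).comp (E.raw.map g) z = v := by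
  induction E with
  | names => exact ⟨v, isSafe_of_injective (fun _ _ h => h) v, rfl⟩
  | const K => exact ⟨v, isSafe_of_injective (fun _ _ h => h) v, rfl⟩
  | id => exact h v
  | coprod ι F ih =>
    obtain ⟨i, v, rfl⟩ := exists_inj v
    obtain ⟨z, hz, hv⟩ := ih i v
    exact ⟨inj i z, (isSafe_coprodMap (f := fun i => ((F i).quot Y).comp ((F i).raw.map g))).2 hz,
      congrArg (inj (X := fun i => (F i).obj Y) i) hv⟩
  | prod F G ihF ihG =>
    obtain ⟨v₁, v₂, rfl⟩ := exists_pair v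
    exact exists_isSafe_prodMap ihF ihG v₁ v₂
  | abs F ih =>
    obtain ⟨x, v, rfl⟩ := exists_bind v
    obtain ⟨z, hz, hv⟩ := exists_isSafe_prodMap (f₁ := MulActionHom.id _)
      (fun a => ⟨a, isSafe_of_injective (fun _ _ h => h) a, rfl⟩) ih (name x) v
    exact ⟨z, isSafe_theta_comp.2 hz, congrArg (theta _) hv⟩

theorem isSafeSquare_chainMap (E : FunctorExpr V) (n : ℕ) :
    IsSafeSquare (E.raw.chainMap n) (E.alphaMap n) (E.alphaMap (n + 1)) (E.chainMap n) := by
  induction n with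
  | zero =>
    refine ⟨fun _ => rfl, fun u v _ _ _ => ?_⟩
    obtain ⟨z, hz, hv⟩ := E.exists_isSafe_quot_map (g := E.alphaMap 0)
      (fun v => ⟨v, isSafe_of_injective (fun _ _ h => h) v, rfl⟩) v
    exact ⟨z, hz, rfl, hv⟩
  | succ n ih => exact E.isSafeSquare_map ih

end FunctorExpr

end NomSquare

theorem mainTheorem9 {V : Type u} [DecidableEq V] [Countable V] [Infinite V]
    (E : NomSquare.FunctorExpr V) (n : ℕ) :
    NomSquare.IsSafeSquare (E.raw.chainMap n) (E.alphaMap n) (E.alphaMap (n + 1))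
      (E.chainMap n) :=
  E.isSafeSquare_chainMap n
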